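/- Let $p$ be a prime, $R=W(\mathbf F_p)$ (so $R\cong\mathbf Z_p$), and let $C=V(f)=\operatorname{Spec}R[x,y]/(f)$ be a plane curve over $R$, where $f\in R[x,y]$ is not constant modulo $p$. For a ring $B$ let $B_{p,1}$ be its first $p$-jet ring, i.e. the $B$-algebra generated by symbols $\delta(b)$, $b\in B$, subject to the relations that make $\delta:B\to B_{p,1}$ a $p$-derivation: $$\delta(1)=0,\quad \delta(a+b)=\delta(a)+\delta(b)+\tfrac{a^p+b^p-(a+b)^p}{p},\quad \delta(ab)=\delta(a)b^p+a^p\delta(b)+p\,\delta(a)\delta(b),$$ and write $J^1_p(\operatorname{Spec} B)$ for $\operatorname{Spec} B_{p,1}$. For a ring $S$ let $A_n(S)$ be the set of automorphisms of the affine line over $S$ of the form $$T\mapsto a_0+a_1T+p\,a_2T^2+\cdots+p^{n-1}a_nT^n,\qquad a_i\in S,\ a_1\in S^\times .$$ Let $U=D(f_x)$ and $V=D(f_y)$ be the principal open subsets of $C$ where the partial derivatives $f_x$, respectively $f_y$, are invertible. The projection of $U$ to the $y$-axis and the projection of $V$ to the $x$-axis are étale, and for every $n\ge 0$ they induce trivializations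 modulo $p^n$ $$\psi_U: J^1_p(U)\to U\times\mathbf A^1,\qquad \psi_V: J^1_p(V)\to V\times\mathbf A^1,$$ i.e. the homomorphisms $(\mathcal O(U)/p^n)[T]\to\mathcal O(U)_{p,1}/p^n$, $T\mapsto\delta(y)$, and $(\mathcal O(V)/p^n)[T]\to\mathcal O(V)_{p,1}/p^n$, $T\mapsto\delta(x)$, over $\mathcal O(U)/p^n$ and $\mathcal O(V)/p^n$ respectively, are isomorphisms. Moreover: 1. If $f_x$ or $f_y$ is not identically zero modulo $p$, then for every $n\ge 2$ the restrictions of $\psi_U$ and $\psi_V$ modulo $p^n$ over $U\cap V=D(f_xf_y)$ (given by $T\mapsto\delta(y)$ and $T\mapsto\delta(x)$) are again isomorphisms, and both transition maps $\psi_V\circ\psi_U^{-1}$ and $\psi_U\circ\psi_V^{-1}$ modulo $p^n$ lie in $A_n\big(\mathcal O(U\cap V)/p^n\big)$. 2. If $\deg f<p$, then $f_x$ or $f_y$ is not identically zero modulo $p$. -/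

import Mathlib

open Polynomial

noncomputable section

namespace PJet

/-! ### The first `p`-jet ring -/

/-- The integral polynomial `C_p(a,b) = (a^p + b^p - (a+b)^p)/p`, evaluated in a commutative ring
(for `p` prime, `p` divides every binomial coefficient occurring here). -/
def cPoly (p : ℕ) {A : Type*} [CommRing A] (a b : A) : A :=
  -∑ k ∈ Finset.Ioo 0 p, ((p.choose k / p : ℕ) : A) * a ^ k * b ^ (p - k)

theorem cPoly_spec (p : ℕ) [hp : Fact p.Prime] {A : Type*} [CommRing A] (a b : A) :
    (p : A) * cPoly p a b = a ^ p + b ^ p - (a + b) ^ p := by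
  have h0 : 0 < p := hp.out.pos
  have h1 : Finset.range (p + 1) = insert 0 (insert p (Finset.Ioo 0 p)) := by
    ext k
    simp only [Finset.mem_range, Finset.mem_insert, Finset.mem_Ioo]
    omega
  have h2 : (p : A) * cPoly p a b =
      -∑ k ∈ Finset.Ioo 0 p, a ^ k * b ^ (p - k) * (p.choose k : A) := by
    rw [cPoly, mul_neg, Finset.mul_sum]
    congr 1
    refine Finset.sum_congr rfl fun k hk => ?_
    obtain ⟨hk0, hkp⟩ := Finset.mem_Ioo.1 hk
    have hd : p ∣ p.choose k := hp.out.dvd_choose_self hk0.ne' hkp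
    conv_rhs => rw [← Nat.mul_div_cancel' hd]
    push_cast
    ring
  rw [h2, add_pow, h1, Finset.sum_insert (by simp; omega), Finset.sum_insert (by simp)]
  simp
  ring

variable (p : ℕ) (B : Type*) [CommRing B]

/-- The relations in `B[ȧ : a ∈ B]` (the variable `MvPolynomial.X a` is `ȧ`) expressing that
`a ↦ ȧ` is a `p`-derivation. -/
inductive JetRel : MvPolynomial B B → Prop
  | one : JetRel (MvPolynomial.X 1)
  | add (a b : B) : JetRel (MvPolynomial.X (a + b) -
      (MvPolynomial.X a + MvPolynomial.X b + MvPolynomial.C (cPoly p a b)))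
  | mul (a b : B) : JetRel (MvPolynomial.X (a * b) -
      (MvPolynomial.X a * MvPolynomial.C (b ^ p) + MvPolynomial.C (a ^ p) * MvPolynomial.X b
        + (p : MvPolynomial B B) * MvPolynomial.X a * MvPolynomial.X b))

/-- The first `p`-jet ring `B_{p,1} = B[ȧ : a ∈ B]/(relations)`, so that `Spec B_{p,1}` is the
first `p`-jet space of `Spec B`. -/
abbrev JetRing : Type _ := MvPolynomial B B ⧸ Ideal.span {q | JetRel p B q}

/-- The reduction `B/p^n`. -/
abbrev ModPow (n : ℕ) : Type _ := B ⧸ Ideal.span {(p : B) ^ n}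

/-- The reduction `B_{p,1}/p^n` of the first `p`-jet ring, i.e. the ring of functions on the first
`p`-jet space of `Spec B` modulo `p^n`. -/
def JetMod (n : ℕ) : Type _ := JetRing p B ⧸ Ideal.span {(p : JetRing p B) ^ n}

instance (n : ℕ) : CommRing (JetMod p B n) :=
  inferInstanceAs (CommRing (JetRing p B ⧸ Ideal.span {(p : JetRing p B) ^ n}))

/-- The quotient map `B_{p,1} → B_{p,1}/p^n`. -/
def JetMod.mk (n : ℕ) : JetRing p B →+* JetMod p B n :=
  Ideal.Quotient.mk (Ideal.span {(p : JetRing p B) ^ n})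

theorem JetMod.p_pow_eq_zero (n : ℕ) : (p : JetMod p B n) ^ n = 0 := by
  have h : JetMod.mk p B n ((p : JetRing p B) ^ n) = 0 :=
    Ideal.Quotient.eq_zero_iff_mem.2 (Ideal.subset_span rfl)
  simpa using h

/-- The structure map `B/p^n → B_{p,1}/p^n` (the projection of the jet space to `Spec B`,
modulo `p^n`). -/
def structureMap (n : ℕ) : ModPow p B n →+* JetMod p B n :=
  Ideal.Quotient.lift (Ideal.span {(p : B) ^ n})
    ((JetMod.mk p B n).comp (algebraMap B (JetRing p B))) (by
      intro a ha
      obtain ⟨c, rfl⟩ := Ideal.mem_span_singleton'.1 ha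
      simp [JetMod.p_pow_eq_zero])

instance (n : ℕ) : Algebra (ModPow p B n) (JetMod p B n) :=
  (structureMap p B n).toAlgebra

variable {B}

/-- The universal `p`-derivation `δ : B → B_{p,1}`, `a ↦ ȧ`, reduced modulo `p^n`. -/
def jetDelta (n : ℕ) (a : B) : JetMod p B n :=
  JetMod.mk p B n (Ideal.Quotient.mk _ (MvPolynomial.X a))

/-- The map `(B/p^n)[T] → B_{p,1}/p^n` of `B/p^n`-algebras sending `T` to `δ(t)`.  When `t` is an
étale coordinate on `Spec B` this is, on functions, the associated trivialization
`J^1(Spec B) → Spec B × 𝔸^1` modulo `p^n`. -/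
def jetChart (n : ℕ) (t : B) : (ModPow p B n)[X] →ₐ[ModPow p B n] JetMod p B n :=
  Polynomial.aeval (jetDelta p n t)

/-- For two coordinates `s, t` on `Spec B` whose maps `jetChart` are isomorphisms, with associated
trivializations `ψ_s, ψ_t` of the jet space modulo `p^n`, this is the automorphism of `(B/p^n)[T]`
given by the transition map `ψ_t ∘ ψ_s⁻¹`.  It sends `T` to the expression of `δ(t)` as a
polynomial in `δ(s)`. -/
def jetTransition (n : ℕ) {s t : B} (hs : Function.Bijective (jetChart p n s))
    (ht : Function.Bijective (jetChart p n t)) :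
    (ModPow p B n)[X] ≃ₐ[ModPow p B n] (ModPow p B n)[X] :=
  (AlgEquiv.ofBijective (jetChart p n t) ht).trans (AlgEquiv.ofBijective (jetChart p n s) hs).symm

theorem jetChart_jetTransition_X (n : ℕ) {s t : B} (hs : Function.Bijective (jetChart p n s))
    (ht : Function.Bijective (jetChart p n t)) :
    jetChart p n s (jetTransition p n hs ht X) = jetDelta p n t := by
  have h := (AlgEquiv.ofBijective (jetChart p n s) hs).apply_symm_apply (jetChart p n t X)
  exact h.trans (Polynomial.aeval_X _)

/-- The set `A_n` of automorphisms `T ↦ a_0 + a_1 T + p a_2 T^2 + ⋯ + p^{n-1} a_n T^n` of the affine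
line over a ring `S` (in which `p^n = 0` in the applications) with `a_1` a unit. -/
def boundedAut (n : ℕ) (S : Type*) [CommRing S] : Set (S[X] ≃ₐ[S] S[X]) :=
  {σ | ∃ a : ℕ → S, IsUnit (a 1) ∧
    σ X = C (a 0) + ∑ i ∈ Finset.Icc 1 n, C ((p : S) ^ (i - 1) * a i) * X ^ i}

/-! ### Restriction to open subsets -/

variable {p} in
theorem cPoly_map {A A' : Type*} [CommRing A] [CommRing A'] (φ : A →+* A') (a b : A) :
    φ (cPoly p a b) = cPoly p (φ a) (φ b) := by
  simp [cPoly]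

/-- Functoriality of the first `p`-jet ring. -/
def jetMap {B' : Type*} [CommRing B'] (φ : B →+* B') : JetRing p B →+* JetRing p B' :=
  Ideal.Quotient.lift _
    ((Ideal.Quotient.mk _).comp
      (MvPolynomial.eval₂Hom (MvPolynomial.C.comp φ) fun a => MvPolynomial.X (φ a))) (by
    have h : Ideal.span {q | JetRel p B q} ≤ RingHom.ker
        ((Ideal.Quotient.mk (Ideal.span {q | JetRel p B' q})).comp
          (MvPolynomial.eval₂Hom (MvPolynomial.C.comp φ) fun a => MvPolynomial.X (φ a))) := by
      refine Ideal.span_le.2 ?_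
      rintro q (_ | ⟨a, b⟩ | ⟨a, b⟩) <;>
        refine Ideal.Quotient.eq_zero_iff_mem.2 (Ideal.subset_span ?_)
      · simpa using JetRel.one
      · have h := JetRel.add (p := p) (φ a) (φ b)
        simpa only [Set.mem_ofPred_eq, map_sub, map_add, MvPolynomial.eval₂Hom_X',
          MvPolynomial.eval₂Hom_C, RingHom.comp_apply, cPoly_map] using h
      · simpa using JetRel.mul (p := p) (φ a) (φ b)
    intro a ha
    exact h ha)

/-- Functoriality of the first `p`-jet ring modulo `p^n`. -/
def jetModMap (n : ℕ) {B' : Type*} [CommRing B'] (φ : B →+* B') : JetMod p B n →+* JetMod p B' n :=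
  Ideal.Quotient.lift (Ideal.span {(p : JetRing p B) ^ n}) ((JetMod.mk p B' n).comp (jetMap p φ)) (by
    intro a ha
    obtain ⟨c, rfl⟩ := Ideal.mem_span_singleton'.1 ha
    simp [JetMod.p_pow_eq_zero])

/-- Functoriality of `B/p^n`. -/
def modPowMap (n : ℕ) {B' : Type*} [CommRing B'] (φ : B →+* B') : ModPow p B n →+* ModPow p B' n :=
  Ideal.quotientMap _ φ (by
    rw [Ideal.span_le, Set.singleton_subset_iff]
    exact Ideal.subset_span (by simp))

/-- The charts are compatible with restriction: `jetChart` for the image of `t` in `B'` is the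
restriction of `jetChart` for `t` along `B → B'`. -/
theorem jetModMap_jetChart (n : ℕ) {B' : Type*} [CommRing B'] (φ : B →+* B') (t : B)
    (F : (ModPow p B n)[X]) :
    jetModMap p n φ (jetChart p n t F) = jetChart p n (φ t) (F.map (modPowMap p n φ)) := by
  have h : (jetModMap p n φ).comp (jetChart p n t).toRingHom =
      (jetChart p n (φ t)).toRingHom.comp (Polynomial.mapRingHom (modPowMap p n φ)) := by
    refine Polynomial.ringHom_ext' (Ideal.Quotient.ringHom_ext ?_) ?_
    · ext b
      have h1 : jetChart p n t (C (Ideal.Quotient.mk _ b)) =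
          structureMap p B n (Ideal.Quotient.mk _ b) := Polynomial.aeval_C _ _
      have h2 : jetChart p n (φ t) (C (modPowMap p n φ (Ideal.Quotient.mk _ b))) =
          structureMap p B' n (Ideal.Quotient.mk _ (φ b)) := Polynomial.aeval_C _ _
      have h3 : jetModMap p n φ (structureMap p B n (Ideal.Quotient.mk _ b)) =
          JetMod.mk p B' n (jetMap p φ (Ideal.Quotient.mk _ (MvPolynomial.C b))) := rfl
      have h4 : jetMap p φ (Ideal.Quotient.mk _ (MvPolynomial.C b)) =
          Ideal.Quotient.mk _ (MvPolynomial.C (φ b)) := by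
        simp [jetMap]
      simp only [RingHom.comp_apply, AlgHom.toRingHom_eq_coe, RingHom.coe_coe,
        Polynomial.coe_mapRingHom, Polynomial.map_C, h1, h2, h3, h4]
      rfl
    · have h1 : jetModMap p n φ (jetDelta p n t) = JetMod.mk p B' n
          (jetMap p φ (Ideal.Quotient.mk _ (MvPolynomial.X t))) := rfl
      have h4 : jetMap p φ (Ideal.Quotient.mk _ (MvPolynomial.X t)) =
          Ideal.Quotient.mk _ (MvPolynomial.X (φ t)) := by
        simp [jetMap]
      have h2 : jetChart p n t X = jetDelta p n t := Polynomial.aeval_X _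
      have h3 : jetChart p n (φ t) X = jetDelta p n (φ t) := Polynomial.aeval_X _
      simp only [RingHom.comp_apply, AlgHom.toRingHom_eq_coe, RingHom.coe_coe,
        Polynomial.coe_mapRingHom, Polynomial.map_X, h1, h2, h3, h4]
      rfl
  exact congrArg (fun g : (ModPow p B n)[X] →+* JetMod p B' n => g F) h

/-! ### Plane curves over the Witt vectors of `𝔽_p` -/

variable [Fact p.Prime]

/-- The ring `R = W(𝔽_p)` of `p`-typical Witt vectors of `𝔽_p`. -/
abbrev BaseRing : Type := WittVector p (ZMod p)

/-- The polynomial ring `R[x,y]`, with `x = X 0` and `y = X 1`. -/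
abbrev PlaneRing : Type := MvPolynomial (Fin 2) (BaseRing p)

variable {p}

/-- Reduction modulo `p` of a polynomial in `R[x,y]`. -/
def reduce (f : PlaneRing p) :
    MvPolynomial (Fin 2) (BaseRing p ⧸ Ideal.span {(p : BaseRing p)}) :=
  MvPolynomial.map (Ideal.Quotient.mk _) f

/-- `V(f)` is a plane curve over `R`: modulo `p`, the equation `f` is not a constant. -/
def IsPlaneCurve (f : PlaneRing p) : Prop :=
  ∀ c, reduce f ≠ MvPolynomial.C c

/-- The ring `R[x,y]/(f)` of functions on `V(f)`. -/
abbrev CurveRing (f : PlaneRing p) : Type := PlaneRing p ⧸ Ideal.span {f}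

/-- The ring of functions on the principal open subset `D(g)` of `V(f)`. -/
abbrev OpenRing (f g : PlaneRing p) : Type :=
  Localization.Away (Ideal.Quotient.mk (Ideal.span {f}) g)

/-- The coordinate functions `x` (`i = 0`) and `y` (`i = 1`) on `D(g) ⊆ V(f)`. -/
def coord (f g : PlaneRing p) (i : Fin 2) : OpenRing f g :=
  algebraMap (CurveRing f) (OpenRing f g) (Ideal.Quotient.mk _ (MvPolynomial.X i))

/-- The projection of `D(g) ⊆ V(f)` to the `i`-th coordinate axis, on functions: `R[T] → 𝒪(D(g))`,
`T ↦ x` or `T ↦ y`. -/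
def axisProj (f g : PlaneRing p) (i : Fin 2) : (BaseRing p)[X] →ₐ[BaseRing p] OpenRing f g :=
  Polynomial.aeval (coord f g i)

/-- The partial derivative `f_x`. -/
abbrev dX (f : PlaneRing p) : PlaneRing p := MvPolynomial.pderiv 0 f

/-- The partial derivative `f_y`. -/
abbrev dY (f : PlaneRing p) : PlaneRing p := MvPolynomial.pderiv 1 f

end PJet

end

/-! A `p`-derivation over a ring map `B → A` is the same as a lift of that map to the length-two
Witt vectors of `A`. So `B_{p,1}/p^n` classifies homomorphisms from `B` to the Witt vectors of rings
`S` with `p^n = 0`. For such `S` the kernel of the projection to `S` is nilpotent, because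
`(0,b)(0,c) = (0,pbc)`. If `t` is a formally étale coordinate on `B` over `R`, a lift of a given `B
→ S` is therefore freely and uniquely determined by the second component of the image of `t`; on `R`
itself there is no choice, since two maps from `R` to a ring where `p` is nilpotent agree. Hence the
jet ring modulo `p^n` is a polynomial ring in `δ(t)` (`exists_jetChart_inverse`).

The shape of the transition maps comes from doing this lifting in a smaller ring. Put `S = B/p^n`.
The pairs `(a, P)` with `a` in `S` and `p^(i-1)` dividing the `i`-th coefficient of `P` form a
subring `boundedWitt` of the Witt vectors of `S[T]`: the one term of the product that is quadratic
in second components carries a factor `p`. This subring contains `(t, T)` and the image of `R`, and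
it surjects onto `S` with nilpotent kernel. So every `δ(b)` is a bounded polynomial in `δ(t)`, and
`p^n = 0` removes all degrees above `n`. The linear coefficient of a transition map is a unit by the
chain rule (`isUnit_coeff_one_of_algEquiv`).

The projections are étale by one Newton step in the coordinate whose partial derivative is
invertible (`axisProj_formallyEtale`). For `deg f < p`, differentiation multiplies coefficients only
by exponents prime to `p`, so it cannot kill a nonconstant reduction
(`exists_reduce_pderiv_ne_zero`). -/

noncomputable section

namespace PJet

/-! ### Witt vectors of length two -/

/-- The ring of `p`-typical Witt vectors of length two, with the addition and the multiplication
that make the ring homomorphisms `B → WittTwo p A` lifting `φ : B → A` the same as the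
`p`-derivations `B → A` over `φ`. -/
@[ext]
structure WittTwo (p : ℕ) (A : Type*) where
  /-- The zeroth component. -/
  fst : A
  /-- The first component. -/
  snd : A

theorem cPoly_zero_right (p : ℕ) {A : Type*} [CommRing A] (a : A) : cPoly p a 0 = 0 := by
  rw [cPoly, neg_eq_zero]
  refine Finset.sum_eq_zero fun k hk => ?_
  rw [zero_pow (by have := Finset.mem_Ioo.1 hk; omega), mul_zero]

namespace WittTwo

variable {p : ℕ} {A A' : Type*} [CommRing A] [CommRing A']

instance : Zero (WittTwo p A) := ⟨⟨0, 0⟩⟩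
instance : One (WittTwo p A) := ⟨⟨1, 0⟩⟩
instance : Add (WittTwo p A) := ⟨fun v w => ⟨v.fst + w.fst, v.snd + w.snd + cPoly p v.fst w.fst⟩⟩
-- For an odd prime the correction term vanishes; for `p = 2` it is the square of the first
-- component.
instance : Neg (WittTwo p A) := ⟨fun v => ⟨-v.fst, -v.snd - cPoly p (-v.fst) v.fst⟩⟩
instance : Mul (WittTwo p A) :=
  ⟨fun v w => ⟨v.fst * w.fst, v.snd * w.fst ^ p + v.fst ^ p * w.snd + p * v.snd * w.snd⟩⟩

@[simp] theorem zero_fst : (0 : WittTwo p A).fst = 0 := rfl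
@[simp] theorem zero_snd : (0 : WittTwo p A).snd = 0 := rfl
@[simp] theorem one_fst : (1 : WittTwo p A).fst = 1 := rfl
@[simp] theorem one_snd : (1 : WittTwo p A).snd = 0 := rfl
@[simp] theorem add_fst (v w : WittTwo p A) : (v + w).fst = v.fst + w.fst := rfl
@[simp] theorem add_snd (v w : WittTwo p A) :
    (v + w).snd = v.snd + w.snd + cPoly p v.fst w.fst := rfl
@[simp] theorem neg_fst (v : WittTwo p A) : (-v).fst = -v.fst := rfl
@[simp] theorem neg_snd (v : WittTwo p A) : (-v).snd = -v.snd - cPoly p (-v.fst) v.fst := rfl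
@[simp] theorem mul_fst (v w : WittTwo p A) : (v * w).fst = v.fst * w.fst := rfl
@[simp] theorem mul_snd (v w : WittTwo p A) : (v * w).snd =
    v.snd * w.fst ^ p + v.fst ^ p * w.snd + p * v.snd * w.snd := rfl

/-- The ghost component `a ^ p + p b` of `(a, b)`. -/
def ghost (v : WittTwo p A) : A := v.fst ^ p + p * v.snd

theorem ghost_one : ghost (1 : WittTwo p A) = 1 := by simp [ghost]

theorem ghost_mul (v w : WittTwo p A) : ghost (v * w) = ghost v * ghost w := by
  simp only [ghost, mul_fst, mul_snd]; ring

/-- Without `p`-torsion the second component can be recovered from the ghost component. This turns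
identities of Witt vectors into identities in `A`. -/
theorem ext_ghost (hA : ∀ a b : A, (p : A) * a = p * b → a = b) {v w : WittTwo p A}
    (h₁ : v.fst = w.fst) (h₂ : ghost v = ghost w) : v = w := by
  refine WittTwo.ext h₁ (hA _ _ ?_)
  rw [ghost, ghost, h₁] at h₂
  exact add_left_cancel h₂

/-- Functoriality of the Witt vectors of length two, as a map of sets. -/
def mapFun (φ : A →+* A') (v : WittTwo p A) : WittTwo p A' := ⟨φ v.fst, φ v.snd⟩

@[simp] theorem mapFun_fst (φ : A →+* A') (v : WittTwo p A) : (mapFun φ v).fst = φ v.fst := rfl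
@[simp] theorem mapFun_snd (φ : A →+* A') (v : WittTwo p A) : (mapFun φ v).snd = φ v.snd := rfl

theorem mapFun_zero (φ : A →+* A') : mapFun φ (0 : WittTwo p A) = 0 := by ext <;> simp
theorem mapFun_one (φ : A →+* A') : mapFun φ (1 : WittTwo p A) = 1 := by ext <;> simp
theorem mapFun_add (φ : A →+* A') (v w : WittTwo p A) :
    mapFun φ (v + w) = mapFun φ v + mapFun φ w := by ext <;> simp [cPoly_map]
theorem mapFun_neg (φ : A →+* A') (v : WittTwo p A) : mapFun φ (-v) = -mapFun φ v := by
  ext <;> simp [cPoly_map]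
theorem mapFun_mul (φ : A →+* A') (v w : WittTwo p A) :
    mapFun φ (v * w) = mapFun φ v * mapFun φ w := by ext <;> simp

/-- Every ring is a quotient of a polynomial ring over `ℤ`. -/
def presentation (A : Type*) [CommRing A] : MvPolynomial A ℤ →+* A :=
  (MvPolynomial.aeval id : MvPolynomial A ℤ →ₐ[ℤ] A).toRingHom

theorem mapFun_presentation_surjective :
    Function.Surjective (mapFun (p := p) (presentation A)) := fun v =>
  ⟨⟨MvPolynomial.X v.fst, MvPolynomial.X v.snd⟩, by ext <;> simp [presentation]⟩

variable [hp : Fact p.Prime]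

theorem ghost_zero : ghost (0 : WittTwo p A) = 0 := by simp [ghost, hp.out.ne_zero]

theorem ghost_add (v w : WittTwo p A) : ghost (v + w) = ghost v + ghost w := by
  simp only [ghost, add_fst, add_snd, mul_add, cPoly_spec]; ring

theorem ghost_neg (v : WittTwo p A) : ghost (-v) = -ghost v := by
  simp only [ghost, neg_fst, neg_snd, mul_sub, cPoly_spec, neg_add_cancel,
    zero_pow hp.out.ne_zero]
  ring

theorem mvPolynomial_ext {σ : Type*} {v w : WittTwo p (MvPolynomial σ ℤ)}
    (h₁ : v.fst = w.fst) (h₂ : ghost v = ghost w) : v = w :=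
  ext_ghost (fun _ _ h => mul_left_cancel₀ (Nat.cast_ne_zero.2 hp.out.ne_zero) h) h₁ h₂

/-- Apart from commutativity and the unit law, the axioms are pulled back to a polynomial ring over
`ℤ`, where `p` is a nonzerodivisor. There they may be tested on first and ghost components, both of
which respect the operations. -/
instance : CommRing (WittTwo p A) :=
  CommRing.ofMinimalAxioms
    (by
      intro a b c
      obtain ⟨a, rfl⟩ := mapFun_presentation_surjective a
      obtain ⟨b, rfl⟩ := mapFun_presentation_surjective b
      obtain ⟨c, rfl⟩ := mapFun_presentation_surjective c
      simp only [← mapFun_add]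
      exact congrArg _ (mvPolynomial_ext (by simp only [add_fst]; ring)
        (by simp only [ghost_add]; ring)))
    (by
      intro a
      obtain ⟨a, rfl⟩ := mapFun_presentation_surjective a
      rw [← mapFun_zero (presentation A), ← mapFun_add]
      exact congrArg _ (mvPolynomial_ext (by simp) (by simp only [ghost_add, ghost_zero]; ring)))
    (by
      intro a
      obtain ⟨a, rfl⟩ := mapFun_presentation_surjective a
      rw [← mapFun_zero (presentation A), ← mapFun_neg, ← mapFun_add]
      exact congrArg _ (mvPolynomial_ext (by simp)
        (by simp only [ghost_add, ghost_zero, ghost_neg]; ring)))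
    (by
      intro a b c
      obtain ⟨a, rfl⟩ := mapFun_presentation_surjective a
      obtain ⟨b, rfl⟩ := mapFun_presentation_surjective b
      obtain ⟨c, rfl⟩ := mapFun_presentation_surjective c
      simp only [← mapFun_mul]
      exact congrArg _ (mvPolynomial_ext (by simp only [mul_fst]; ring)
        (by simp only [ghost_mul]; ring)))
    (by
      intro a b
      ext
      · simp only [mul_fst]; ring
      · simp only [mul_snd]; ring)
    (by
      intro a
      ext <;> simp)
    (by
      intro a b c
      obtain ⟨a, rfl⟩ := mapFun_presentation_surjective a
      obtain ⟨b, rfl⟩ := mapFun_presentation_surjective b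
      obtain ⟨c, rfl⟩ := mapFun_presentation_surjective c
      simp only [← mapFun_mul, ← mapFun_add]
      exact congrArg _ (mvPolynomial_ext (by simp only [mul_fst, add_fst]; ring)
        (by simp only [ghost_mul, ghost_add]; ring)))

/-- Functoriality of the Witt vectors of length two. -/
def map (φ : A →+* A') : WittTwo p A →+* WittTwo p A' where
  toFun := mapFun φ
  map_zero' := mapFun_zero φ
  map_one' := mapFun_one φ
  map_add' := mapFun_add φ
  map_mul' := mapFun_mul φ

@[simp] theorem map_fst (φ : A →+* A') (v : WittTwo p A) : (map φ v).fst = φ v.fst := rfl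
@[simp] theorem map_snd (φ : A →+* A') (v : WittTwo p A) : (map φ v).snd = φ v.snd := rfl

variable (p A) in
/-- The projection to the zeroth component. -/
def fstHom : WittTwo p A →+* A where
  toFun := fst
  map_zero' := rfl
  map_one' := rfl
  map_add' _ _ := rfl
  map_mul' _ _ := rfl

@[simp] theorem fstHom_apply (v : WittTwo p A) : fstHom p A v = v.fst := rfl

/-- Each multiplication inside the kernel gains one factor `p`, by `(0,b)(0,c) = (0,pbc)`; the first
factor gains none, hence the shift between the exponents. -/
theorem dvd_snd_of_mem_ker_pow (k : ℕ) : ∀ v ∈ RingHom.ker (fstHom p A) ^ (k + 1),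
    v.fst = 0 ∧ (p : A) ^ k ∣ v.snd := by
  induction k with
  | zero => intro v hv; simpa [RingHom.mem_ker] using hv
  | succ k ih =>
    intro v hv
    rw [pow_succ] at hv
    refine Submodule.mul_induction_on hv ?_ ?_
    · intro a ha b hb
      obtain ⟨ha, c, hc⟩ := ih a ha
      rw [RingHom.mem_ker, fstHom_apply] at hb
      refine ⟨by simp [ha], c * b.snd, ?_⟩
      simp only [mul_snd, ha, hb, zero_pow hp.out.ne_zero, hc]
      ring
    · rintro a b ⟨ha, ha'⟩ ⟨hb, hb'⟩
      refine ⟨by simp [ha, hb], ?_⟩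
      rw [add_snd, hb, cPoly_zero_right, add_zero]
      exact dvd_add ha' hb'

theorem isNilpotent_ker_fstHom {n : ℕ} (h : (p : A) ^ n = 0) :
    IsNilpotent (RingHom.ker (fstHom p A)) := by
  refine ⟨n + 1, (Submodule.eq_bot_iff _).2 fun v hv => ?_⟩
  obtain ⟨h₁, h₂⟩ := dvd_snd_of_mem_ker_pow n v hv
  rw [h, zero_dvd_iff] at h₂
  exact WittTwo.ext h₁ h₂

theorem isNilpotent_natCast {n : ℕ} (h : (p : A) ^ n = 0) : IsNilpotent (p : WittTwo p A) := by
  have h₁ : (p : WittTwo p A) ^ n ∈ RingHom.ker (fstHom p A) := by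
    rw [RingHom.mem_ker, map_pow, map_natCast, h]
  obtain ⟨k, hk⟩ := isNilpotent_ker_fstHom h
  refine ⟨n * k, ?_⟩
  have h₂ := Ideal.pow_mem_pow h₁ k
  rw [hk] at h₂
  rw [pow_mul]
  exact h₂

end WittTwo

/-! ### The first jet ring and Witt vectors of length two -/

section

variable {p : ℕ} {B : Type*} [CommRing B]

theorem jetDelta_one (n : ℕ) : jetDelta p n (1 : B) = 0 := by
  have h : Ideal.Quotient.mk (Ideal.span {q | JetRel p B q}) (MvPolynomial.X 1) = 0 :=
    Ideal.Quotient.eq_zero_iff_mem.2 (Ideal.subset_span JetRel.one)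
  rw [jetDelta, h, map_zero]

theorem algebraMap_mk (n : ℕ) (b : B) :
    algebraMap (ModPow p B n) (JetMod p B n) (Ideal.Quotient.mk _ b) =
      JetMod.mk p B n (Ideal.Quotient.mk _ (MvPolynomial.C b)) := rfl

theorem jetDelta_add (n : ℕ) (a b : B) : jetDelta p n (a + b) = jetDelta p n a + jetDelta p n b +
    cPoly p (algebraMap (ModPow p B n) (JetMod p B n) (Ideal.Quotient.mk _ a))
      (algebraMap (ModPow p B n) (JetMod p B n) (Ideal.Quotient.mk _ b)) := by
  have h := congrArg (JetMod.mk p B n)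
    (Ideal.Quotient.eq.2 (Ideal.subset_span (JetRel.add (p := p) a b)))
  simp only [map_add, cPoly_map, ← algebraMap_mk] at h
  exact h

theorem jetDelta_mul (n : ℕ) (a b : B) : jetDelta p n (a * b) =
    jetDelta p n a * algebraMap (ModPow p B n) (JetMod p B n) (Ideal.Quotient.mk _ b) ^ p +
      algebraMap (ModPow p B n) (JetMod p B n) (Ideal.Quotient.mk _ a) ^ p * jetDelta p n b +
      p * jetDelta p n a * jetDelta p n b := by
  have h := congrArg (JetMod.mk p B n)
    (Ideal.Quotient.eq.2 (Ideal.subset_span (JetRel.mul (p := p) a b)))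
  simp only [map_add, map_mul, map_pow, map_natCast, ← algebraMap_mk] at h
  exact h

theorem jetMod_hom_ext {S : Type*} [CommRing S] {n : ℕ} {φ ψ : JetMod p B n →+* S}
    (h₁ : ∀ b : B, φ (algebraMap (ModPow p B n) (JetMod p B n) (Ideal.Quotient.mk _ b)) =
      ψ (algebraMap (ModPow p B n) (JetMod p B n) (Ideal.Quotient.mk _ b)))
    (h₂ : ∀ b : B, φ (jetDelta p n b) = ψ (jetDelta p n b)) : φ = ψ := by
  refine Ideal.Quotient.ringHom_ext (Ideal.Quotient.ringHom_ext (MvPolynomial.ringHom_ext ?_ ?_))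
  · exact h₁
  · exact h₂

variable [hp : Fact p.Prime]

variable (p B) in
/-- The homomorphism `b ↦ (b, δ(b))` to the Witt vectors of the jet ring modulo `p^n`. -/
def jetWitt (n : ℕ) : B →+* WittTwo p (JetMod p B n) :=
  RingHom.mk'
    { toFun := fun b =>
        ⟨algebraMap (ModPow p B n) (JetMod p B n) (Ideal.Quotient.mk _ b), jetDelta p n b⟩
      map_one' := by ext <;> simp [jetDelta_one]
      map_mul' := fun a b => by ext <;> simp [jetDelta_mul] }
    fun a b => by ext <;> simp [jetDelta_add]

@[simp] theorem jetWitt_fst (n : ℕ) (b : B) : (jetWitt p B n b).fst =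
    algebraMap (ModPow p B n) (JetMod p B n) (Ideal.Quotient.mk _ b) := rfl

@[simp] theorem jetWitt_snd (n : ℕ) (b : B) : (jetWitt p B n b).snd = jetDelta p n b := rfl

/-- The homomorphism out of the jet ring given by a homomorphism to the Witt vectors. -/
def jetLift {S : Type*} [CommRing S] (w : B →+* WittTwo p S) : JetRing p B →+* S :=
  Ideal.Quotient.lift _
    (MvPolynomial.eval₂Hom ((WittTwo.fstHom p S).comp w) fun b => (w b).snd) (by
    have h : Ideal.span {q | JetRel p B q} ≤ RingHom.ker
        (MvPolynomial.eval₂Hom ((WittTwo.fstHom p S).comp w) fun b => (w b).snd) := by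
      refine Ideal.span_le.2 ?_
      rintro q (_ | ⟨a, b⟩ | ⟨a, b⟩)
      · simp [RingHom.mem_ker]
      · simp only [SetLike.mem_coe, RingHom.mem_ker, map_sub, map_add, cPoly_map]
        simp
      · simp [RingHom.mem_ker]
    intro a ha
    exact h ha)

/-- The homomorphism out of the jet ring modulo `p^n` given by a homomorphism to the Witt
vectors. -/
def jetModLift {S : Type*} [CommRing S] (n : ℕ) (hS : (p : S) ^ n = 0) (w : B →+* WittTwo p S) :
    JetMod p B n →+* S :=
  Ideal.Quotient.lift (Ideal.span {(p : JetRing p B) ^ n}) (jetLift w) (by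
    intro a ha
    obtain ⟨c, rfl⟩ := Ideal.mem_span_singleton'.1 ha
    simp [hS])

theorem jetModLift_algebraMap {S : Type*} [CommRing S] (n : ℕ) (hS : (p : S) ^ n = 0)
    (w : B →+* WittTwo p S) (b : B) :
    jetModLift n hS w (algebraMap (ModPow p B n) (JetMod p B n) (Ideal.Quotient.mk _ b)) =
      (w b).fst := by
  have h : jetModLift n hS w (algebraMap (ModPow p B n) (JetMod p B n) (Ideal.Quotient.mk _ b)) =
    MvPolynomial.eval₂Hom ((WittTwo.fstHom p S).comp w) (fun b => (w b).snd)
      (MvPolynomial.C b) := rfl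
  rw [h]; simp

theorem jetModLift_jetDelta {S : Type*} [CommRing S] (n : ℕ) (hS : (p : S) ^ n = 0)
    (w : B →+* WittTwo p S) (b : B) : jetModLift n hS w (jetDelta p n b) = (w b).snd := by
  have h : jetModLift n hS w (jetDelta p n b) =
    MvPolynomial.eval₂Hom ((WittTwo.fstHom p S).comp w) (fun b => (w b).snd)
      (MvPolynomial.X b) := rfl
  rw [h]; simp

end

/-! ### The canonical `p`-derivation on the base ring -/

section

variable {p : ℕ} [hp : Fact p.Prime]

/-- The residue field is `𝔽_p`, on which Frobenius is the identity; this is read off in `ℤ_[p]`. -/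
theorem natCast_dvd_sub_pow (r : BaseRing p) : (p : BaseRing p) ∣ r - r ^ p := by
  have h : (p : ℤ_[p]) ∣ WittVector.equiv p r - WittVector.equiv p r ^ p := by
    rw [← Ideal.mem_span_singleton, ← PadicInt.maximalIdeal_eq_span_p, ← PadicInt.ker_toZMod,
      RingHom.mem_ker, map_sub, map_pow, ZMod.pow_card, sub_self]
  have := map_dvd (WittVector.equiv p).symm h
  simpa using this

variable (p) in
/-- The homomorphism `r ↦ (r, (r - r^p)/p)`. -/
def baseWitt : BaseRing p →+* WittTwo p (BaseRing p) := by
  have hA : ∀ a b : BaseRing p, (p : BaseRing p) * a = p * b → a = b := fun _ _ h =>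
    mul_left_cancel₀ (WittVector.p_nonzero p (ZMod p)) h
  let F : BaseRing p → WittTwo p (BaseRing p) := fun r => ⟨r, (natCast_dvd_sub_pow r).choose⟩
  -- The second component is chosen to make the ghost component the identity; compatibility with the
  -- ring operations then follows from `ext_ghost`.
  have hF : ∀ r, (F r).ghost = r := fun r => by
    have := (natCast_dvd_sub_pow r).choose_spec
    simp only [F, WittTwo.ghost, ← this]; ring
  exact RingHom.mk'
    { toFun := F
      map_one' := WittTwo.ext_ghost hA rfl (by rw [hF, WittTwo.ghost_one])
      map_mul' := fun a b => WittTwo.ext_ghost hA rfl (by rw [WittTwo.ghost_mul]; simp only [hF]) }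
    fun a b => WittTwo.ext_ghost hA rfl (by
      rw [WittTwo.ghost_add]; simp only [MonoidHom.coe_mk, OneHom.coe_mk, hF])

@[simp] theorem baseWitt_fst (r : BaseRing p) : (baseWitt p r).fst = r := rfl

theorem baseRing_exists_natCast (r : BaseRing p) (n : ℕ) :
    ∃ (m : ℕ) (s : BaseRing p), r = m + (p : BaseRing p) ^ n * s := by
  obtain ⟨c, hc⟩ := Ideal.mem_span_singleton.1 (PadicInt.appr_spec n (WittVector.equiv p r))
  refine ⟨(WittVector.equiv p r).appr n, (WittVector.equiv p).symm c,
    (WittVector.equiv p).injective ?_⟩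
  simp [← hc]

/-- Modulo `p^n` every element of `R` is a natural number, and a homomorphism has no choice on
those. -/
theorem baseRing_hom_ext {S : Type*} [CommRing S] (hS : IsNilpotent (p : S))
    (φ ψ : BaseRing p →+* S) : φ = ψ := by
  obtain ⟨n, hn⟩ := hS
  ext r
  obtain ⟨m, s, rfl⟩ := baseRing_exists_natCast r n
  simp [hn]

end

/-! ### Lifting along formally étale homomorphisms -/

section

variable {Q B E S : Type*} [CommRing Q] [CommRing B] [CommRing E] [CommRing S] {ρ : Q →+* B}

theorem exists_lift_of_formallyEtale (hρ : ρ.FormallyEtale) {π : E →+* S}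
    (hπ : Function.Surjective π) (hker : IsNilpotent (RingHom.ker π)) {u : Q →+* E} {v : B →+* S}
    (h : π.comp u = v.comp ρ) : ∃ w : B →+* E, π.comp w = v ∧ w.comp ρ = u := by
  algebraize [ρ, u, π.comp u]
  have : Algebra.FormallyEtale Q B := hρ
  let v' : B →ₐ[Q] S := { v with commutes' := fun q => (RingHom.congr_fun h q).symm }
  let π' : E →ₐ[Q] S := { π with commutes' := fun q => rfl }
  have hker' : IsNilpotent (RingHom.ker (π' : E →+* S)) := hker
  refine ⟨Algebra.FormallySmooth.liftOfSurjective v' π' hπ hker', ?_, ?_⟩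
  · ext b
    exact Algebra.FormallySmooth.liftOfSurjective_apply v' π' hπ hker' b
  · ext q
    exact (Algebra.FormallySmooth.liftOfSurjective v' π' hπ hker').commutes q

theorem lift_unique_of_formallyEtale (hρ : ρ.FormallyEtale) {π : E →+* S}
    (hker : IsNilpotent (RingHom.ker π)) {w w' : B →+* E}
    (h₁ : π.comp w = π.comp w') (h₂ : w.comp ρ = w'.comp ρ) : w = w' := by
  algebraize [ρ, w.comp ρ]
  have : Algebra.FormallyEtale Q B := hρ
  let g : B →ₐ[Q] E := { w with commutes' := fun q => rfl }
  let g' : B →ₐ[Q] E := { w' with commutes' := fun q => (RingHom.congr_fun h₂ q).symm }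
  have h := Algebra.FormallyUnramified.lift_unique_of_ringHom π hker g g' h₁
  ext b
  exact AlgHom.congr_fun h b

/-- Lets a subring such as `boundedWitt` inherit nilpotency from the full ring of Witt vectors. -/
theorem isNilpotent_ker_comp {F : Type*} [CommRing F] {ι : F →+* E} (hι : Function.Injective ι)
    {π : E →+* S} (hker : IsNilpotent (RingHom.ker π)) : IsNilpotent (RingHom.ker (π.comp ι)) := by
  obtain ⟨k, hk⟩ := hker
  refine ⟨k, (Submodule.eq_bot_iff _).2 fun x hx => hι ?_⟩
  rw [map_zero, ← Ideal.mem_bot, ← Ideal.zero_eq_bot, ← hk]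
  have h₁ : Ideal.map ι (RingHom.ker (π.comp ι)) ≤ RingHom.ker π :=
    Ideal.map_le_iff_le_comap.2 fun y hy => hy
  refine Ideal.pow_right_mono h₁ k ?_
  rw [← Ideal.map_pow]
  exact Ideal.mem_map_of_mem ι hx

end

/-! ### Polynomials whose coefficients are divisible by powers of `p` -/

/-- Polynomials `a_0 + a_1 T + p a_2 T^2 + p^2 a_3 T^3 + ⋯`. -/
def IsBounded (p : ℕ) {S : Type*} [CommRing S] (P : S[X]) : Prop :=
  ∀ i, (p : S) ^ (i - 1) ∣ P.coeff i

section

variable {p : ℕ} {S : Type*} [CommRing S]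

theorem isBounded_C (a : S) : IsBounded p (C a) := fun i => by
  rcases i with _ | i
  · simp
  · simp

theorem isBounded_X : IsBounded p (X : S[X]) := fun i => by
  rw [coeff_X]
  split_ifs with h
  · simp [← h]
  · exact dvd_zero _

theorem IsBounded.add {P Q : S[X]} (hP : IsBounded p P) (hQ : IsBounded p Q) :
    IsBounded p (P + Q) := fun i => by
  rw [coeff_add]
  exact dvd_add (hP i) (hQ i)

theorem IsBounded.neg {P : S[X]} (hP : IsBounded p P) : IsBounded p (-P) := fun i => by
  rw [coeff_neg]
  exact (hP i).neg_right

theorem IsBounded.C_mul (a : S) {P : S[X]} (hP : IsBounded p P) : IsBounded p (C a * P) :=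
  fun i => by
    rw [coeff_C_mul]
    exact (hP i).mul_left a

/-- The extra `p` is what is needed: `1 + (i-1) + (j-1) ≥ (i+j) - 1`, also with truncated
subtraction when `i` or `j` is zero. -/
theorem IsBounded.natCast_mul_mul {P Q : S[X]} (hP : IsBounded p P) (hQ : IsBounded p Q) :
    IsBounded p ((p : S[X]) * P * Q) := fun k => by
  rw [mul_assoc, ← C_eq_natCast, coeff_C_mul, coeff_mul, Finset.mul_sum]
  refine Finset.dvd_sum fun x hx => ?_
  have hx' := Finset.HasAntidiagonal.mem_antidiagonal.1 hx
  have h := mul_dvd_mul (dvd_refl (p : S)) (mul_dvd_mul (hP x.1) (hQ x.2))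
  rw [← pow_add, ← pow_succ'] at h
  exact (pow_dvd_pow _ (by omega)).trans h

theorem IsBounded.exists_eq_sum {n : ℕ} (hS : (p : S) ^ n = 0) {P : S[X]} (hP : IsBounded p P) :
    ∃ a : ℕ → S, a 1 = P.coeff 1 ∧
      P = C (a 0) + ∑ i ∈ Finset.Icc 1 n, C ((p : S) ^ (i - 1) * a i) * X ^ i := by
  choose a ha using hP
  refine ⟨a, by simpa using (ha 1).symm, ?_⟩
  ext k
  rw [coeff_add, finsetSum_coeff]
  simp only [coeff_C_mul, coeff_X_pow, mul_ite, mul_one, mul_zero, Finset.sum_ite_eq, ← ha]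
  rcases Nat.eq_zero_or_pos k with rfl | hk
  · simpa using ha 0
  · rw [coeff_C_of_ne_zero hk.ne', zero_add]
    split_ifs with h
    · rfl
    -- Here `k > n`, so `k - 1 ≥ n` and the divisor `p^(k-1)` is already zero.
    · rw [ha k, pow_eq_zero_of_le _ hS, zero_mul]
      rw [Finset.mem_Icc] at h
      omega

variable [hp : Fact p.Prime]

variable (p S) in
/-- The subring of pairs `(a, P)` where `a` is constant and `P` is bounded. -/
def boundedWitt : Subring (WittTwo p S[X]) where
  carrier := {v | (∃ a, v.fst = C a) ∧ IsBounded p v.snd}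
  zero_mem' := ⟨⟨0, by simp⟩, by simpa using isBounded_C (p := p) (0 : S)⟩
  one_mem' := ⟨⟨1, by simp⟩, by simpa using isBounded_C (p := p) (0 : S)⟩
  add_mem' := by
    rintro v w ⟨⟨a, ha⟩, hv⟩ ⟨⟨b, hb⟩, hw⟩
    refine ⟨⟨a + b, by simp [ha, hb]⟩, ?_⟩
    -- The carry involves only the constant first components, so it is constant and hence bounded.
    rw [WittTwo.add_snd, ha, hb, ← cPoly_map]
    exact (hv.add hw).add (isBounded_C _)
  neg_mem' := by
    rintro v ⟨⟨a, ha⟩, hv⟩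
    refine ⟨⟨-a, by simp [ha]⟩, ?_⟩
    rw [WittTwo.neg_snd, ha, ← map_neg, ← cPoly_map, sub_eq_add_neg]
    exact hv.neg.add (isBounded_C _).neg
  mul_mem' := by
    rintro v w ⟨⟨a, ha⟩, hv⟩ ⟨⟨b, hb⟩, hw⟩
    refine ⟨⟨a * b, by simp [ha, hb]⟩, ?_⟩
    rw [WittTwo.mul_snd, ha, hb, ← map_pow, ← map_pow, mul_comm v.snd]
    exact ((hv.C_mul _).add (hw.C_mul _)).add (hv.natCast_mul_mul hw)

theorem mem_boundedWitt {v : WittTwo p S[X]} :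
    v ∈ boundedWitt p S ↔ (∃ a, v.fst = C a) ∧ IsBounded p v.snd := Iff.rfl

variable (p S) in
/-- The projection `(a, P) ↦ a`. -/
def boundedWittFst : boundedWitt p S →+* S :=
  (constantCoeff.comp (WittTwo.fstHom p S[X])).comp (boundedWitt p S).subtype

theorem C_boundedWittFst (v : boundedWitt p S) : C (boundedWittFst p S v) = v.1.fst := by
  obtain ⟨a, ha⟩ := (mem_boundedWitt.1 v.2).1
  simp [boundedWittFst, ha]

theorem boundedWittFst_surjective : Function.Surjective (boundedWittFst p S) := fun a =>
  ⟨⟨⟨C a, 0⟩, ⟨a, rfl⟩, by simpa using isBounded_C (p := p) (0 : S)⟩, by simp [boundedWittFst]⟩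

theorem isNilpotent_ker_boundedWittFst {n : ℕ} (hS : (p : S) ^ n = 0) :
    IsNilpotent (RingHom.ker (boundedWittFst p S)) := by
  have hS' : (p : S[X]) ^ n = 0 := by rw [← C_eq_natCast, ← C_pow, hS, C_0]
  have h : C.comp (boundedWittFst p S) =
      (WittTwo.fstHom p S[X]).comp (boundedWitt p S).subtype :=
    RingHom.ext fun v => C_boundedWittFst v
  have h' : RingHom.ker (boundedWittFst p S) = RingHom.ker (C.comp (boundedWittFst p S)) :=
    (RingHom.ker_comp_of_injective _ C_injective).symm
  rw [h', h]
  exact isNilpotent_ker_comp Subtype.val_injective (WittTwo.isNilpotent_ker_fstHom hS')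

end

/-- The linear coefficient of the image of `X` under an automorphism of `S[X]` is a unit. -/
theorem isUnit_coeff_one_of_algEquiv {S : Type*} [CommRing S] (σ : S[X] ≃ₐ[S] S[X]) :
    IsUnit ((σ X).coeff 1) := by
  have h₁ : (σ.symm X).comp (σ X) = X := by
    have h : ∀ P : S[X], σ P = P.comp (σ X) := fun P => by
      have h' := aeval_algHom_apply σ X P
      rw [aeval_X_left_apply] at h'
      rw [comp_eq_aeval, h']
    rw [← h, σ.apply_symm_apply]
  -- By the chain rule at `0`, the derivative of `σ X` there has an explicit inverse.
  have h₂ := congrArg (fun P => eval 0 (derivative P)) h₁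
  simp only [derivative_comp, derivative_X, eval_mul, eval_one] at h₂
  have h₃ : (σ X).coeff 1 = eval 0 (derivative (σ X)) := by
    rw [← coeff_zero_eq_eval_zero, coeff_derivative]; simp
  rw [h₃]
  exact IsUnit.of_mul_eq_one _ h₂

/-! ### Charts given by étale coordinates -/

section

variable {p : ℕ} {B : Type*} [CommRing B]

theorem modPow_pow_eq_zero (n : ℕ) : (p : ModPow p B n) ^ n = 0 := by
  have h : Ideal.Quotient.mk (Ideal.span {(p : B) ^ n}) ((p : B) ^ n) = 0 :=
    Ideal.Quotient.eq_zero_iff_mem.2 (Ideal.subset_span rfl)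
  rwa [map_pow, map_natCast] at h

theorem jetChart_C (n : ℕ) (t : B) (a : ModPow p B n) :
    jetChart p n t (C a) = algebraMap (ModPow p B n) (JetMod p B n) a := aeval_C _ _

theorem jetChart_X (n : ℕ) (t : B) : jetChart p n t X = jetDelta p n t := aeval_X _

variable [hp : Fact p.Prime] [Algebra (BaseRing p) B]

/-- A formally étale coordinate `t` extends to a homomorphism to Witt vectors which sends `t` to
`(t, T)` and has bounded components. -/
theorem exists_boundedWitt_lift {t : B}
    (ht : (aeval t : (BaseRing p)[X] →ₐ[BaseRing p] B).toRingHom.FormallyEtale) (n : ℕ) :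
    ∃ w : B →+* WittTwo p (ModPow p B n)[X],
      (∀ b, (w b).fst = C (Ideal.Quotient.mk _ b)) ∧ (w t).snd = X ∧
        ∀ b, IsBounded p (w b).snd := by
  let S := ModPow p B n
  let α : BaseRing p →+* S := (Ideal.Quotient.mk _).comp (algebraMap (BaseRing p) B)
  let β : BaseRing p →+* boundedWitt p S :=
    ((WittTwo.map (C.comp α)).comp (baseWitt p)).codRestrict (boundedWitt p S)
      fun r => ⟨⟨α r, by simp⟩, isBounded_C _⟩
  let τ : boundedWitt p S := ⟨⟨C (Ideal.Quotient.mk _ t), X⟩, ⟨_, rfl⟩, isBounded_X⟩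
  have hτ : boundedWittFst p S τ = Ideal.Quotient.mk _ t := by simp [boundedWittFst, τ]
  have hβ : ∀ r, boundedWittFst p S (β r) = α r := fun r => by
    rw [← C_inj, C_boundedWittFst]
    rfl
  -- Lifting into the subring `boundedWitt` rather than into all Witt vectors makes every second
  -- component bounded at once.
  obtain ⟨w, hw₁, hw₂⟩ := exists_lift_of_formallyEtale ht
    (boundedWittFst_surjective (p := p) (S := S))
    (isNilpotent_ker_boundedWittFst (modPow_pow_eq_zero n)) (u := eval₂RingHom β τ)
    (v := Ideal.Quotient.mk _) (by
      refine Polynomial.ringHom_ext (fun r => ?_) ?_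
      · rw [RingHom.comp_apply, coe_eval₂RingHom, eval₂_C, hβ]
        change α r = Ideal.Quotient.mk _ (aeval t (C r))
        rw [aeval_C]
        rfl
      · simp [hτ])
  refine ⟨(boundedWitt p S).subtype.comp w, fun b => ?_, ?_, fun b => (w b).2.2⟩
  · rw [← RingHom.congr_fun hw₁ b]
    exact (C_boundedWittFst (w b)).symm
  · have h : w t = τ := by simpa using RingHom.congr_fun hw₂ X
    rw [RingHom.comp_apply, h]
    rfl

/-- The inverse is the map that the universal property of the jet ring attaches to the lift `w`, so
its values on the `δ(b)` are the bounded second components of `w`. -/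
theorem exists_jetChart_inverse {t : B}
    (ht : (aeval t : (BaseRing p)[X] →ₐ[BaseRing p] B).toRingHom.FormallyEtale) (n : ℕ) :
    ∃ θ : JetMod p B n → (ModPow p B n)[X], Function.LeftInverse θ (jetChart p n t) ∧
      Function.RightInverse θ (jetChart p n t) ∧ ∀ b, IsBounded p (θ (jetDelta p n b)) := by
  obtain ⟨w, hw₁, hw₂, hw₃⟩ := exists_boundedWitt_lift ht n
  have hS : (p : (ModPow p B n)[X]) ^ n = 0 := by
    rw [← C_eq_natCast, ← C_pow, modPow_pow_eq_zero, C_0]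
  have hJ : (p : JetMod p B n) ^ n = 0 := JetMod.p_pow_eq_zero p B n
  let θ := jetModLift n hS w
  have hθC : ∀ b : B, θ (algebraMap (ModPow p B n) (JetMod p B n) (Ideal.Quotient.mk _ b)) =
      C (Ideal.Quotient.mk _ b) := fun b => by
    rw [jetModLift_algebraMap, hw₁]
  have hθδ : ∀ b : B, θ (jetDelta p n b) = (w b).snd := jetModLift_jetDelta n hS w
  refine ⟨θ, ?_, ?_, fun b => by rw [hθδ]; exact hw₃ b⟩
  · have h : θ.comp (jetChart p n t : (ModPow p B n)[X] →+* JetMod p B n) = RingHom.id _ := by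
      refine Polynomial.ringHom_ext (fun a => ?_) ?_
      · obtain ⟨b, rfl⟩ := Ideal.Quotient.mk_surjective a
        simpa [jetChart_C] using hθC b
      · simp [jetChart_X, hθδ, hw₂]
    exact fun P => RingHom.congr_fun h P
  -- Both sides lift the structure map `B → B_{p,1}/p^n` and agree on `R[T]`, so uniqueness of étale
  -- lifts identifies them. Second components then show that the chart after `θ` fixes each `δ(b)`.
  · have hw : (WittTwo.map (jetChart p n t : (ModPow p B n)[X] →+* JetMod p B n)).comp w =
        jetWitt p B n := by
      refine lift_unique_of_formallyEtale ht (WittTwo.isNilpotent_ker_fstHom hJ)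
        (RingHom.ext fun b => ?_) (Polynomial.ringHom_ext' ?_ ?_)
      · simp [hw₁, jetChart_C]
      · exact baseRing_hom_ext (WittTwo.isNilpotent_natCast hJ) _ _
      · ext <;> simp [hw₁, hw₂, jetChart_C, jetChart_X]
    have h : (jetChart p n t : (ModPow p B n)[X] →+* JetMod p B n).comp θ = RingHom.id _ := by
      refine jetMod_hom_ext (fun b => ?_) fun b => ?_
      · rw [RingHom.comp_apply, hθC]
        exact jetChart_C _ _ _
      · rw [RingHom.comp_apply, hθδ]
        exact congrArg WittTwo.snd (RingHom.congr_fun hw b)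
    exact fun x => RingHom.congr_fun h x

theorem jetChart_bijective {t : B}
    (ht : (aeval t : (BaseRing p)[X] →ₐ[BaseRing p] B).toRingHom.FormallyEtale) (n : ℕ) :
    Function.Bijective (jetChart p n t) := by
  obtain ⟨θ, h₁, h₂, -⟩ := exists_jetChart_inverse ht n
  exact ⟨h₁.injective, h₂.surjective⟩

/-- The image of `X` is `δ(t)` written as a polynomial in `δ(s)`, so boundedness comes from the
étale coordinate `s`; about `t` only bijectivity of its chart matters. -/
theorem jetTransition_mem_boundedAut {s t : B}
    (hs : (aeval s : (BaseRing p)[X] →ₐ[BaseRing p] B).toRingHom.FormallyEtale) {n : ℕ}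
    (hs' : Function.Bijective (jetChart p n s)) (ht' : Function.Bijective (jetChart p n t)) :
    jetTransition p n hs' ht' ∈ boundedAut p n (ModPow p B n) := by
  obtain ⟨θ, h₁, -, h₃⟩ := exists_jetChart_inverse hs n
  have h : jetTransition p n hs' ht' X = θ (jetDelta p n t) := by
    rw [← jetChart_jetTransition_X p n hs' ht', h₁]
  obtain ⟨a, ha, h₄⟩ := (h₃ t).exists_eq_sum (modPow_pow_eq_zero n)
  rw [← h] at ha h₄
  exact ⟨a, ha ▸ isUnit_coeff_one_of_algEquiv _, h₄⟩

end

/-! ### Étaleness of the projections to the axes -/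

section

theorem formallyEtale_of_existsUnique_lift.{u, v} {Q : Type u} {B : Type v} [CommRing Q] [CommRing B] {ρ : Q →+* B}
    (h : ∀ {E : Type max u v} [CommRing E] (I : Ideal E), I ^ 2 = ⊥ → ∀ (u : Q →+* E) (v : B →+* E ⧸ I),
      (Ideal.Quotient.mk I).comp u = v.comp ρ →
        ∃! w : B →+* E, (Ideal.Quotient.mk I).comp w = v ∧ w.comp ρ = u) :
    ρ.FormallyEtale := by
  algebraize [ρ]
  change Algebra.FormallyEtale Q B
  refine Algebra.FormallyEtale.iff_comp_bijective.2 fun E _ _ I hI => ⟨fun w w' hw => ?_, fun v => ?_⟩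
  · obtain ⟨_, -, h'⟩ := h I hI (algebraMap Q E) ((Ideal.Quotient.mk I).comp (w : B →+* E))
      (RingHom.ext fun q => congrArg (Ideal.Quotient.mk I) (w.commutes q).symm)
    have h₁ := h' (w : B →+* E) ⟨rfl, RingHom.ext w.commutes⟩
    have h₂ := h' (w' : B →+* E) ⟨RingHom.ext fun b => (AlgHom.congr_fun hw b).symm,
      RingHom.ext w'.commutes⟩
    exact AlgHom.ext fun b => RingHom.congr_fun (h₁.trans h₂.symm) b
  · obtain ⟨w, ⟨hw₁, hw₂⟩, -⟩ := h I hI (algebraMap Q E) v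
      (RingHom.ext fun q => (v.commutes q).symm)
    exact ⟨{ w with commutes' := RingHom.congr_fun hw₂ }, AlgHom.ext (RingHom.congr_fun hw₁)⟩

/-- First order Taylor expansion in one variable. -/
theorem eval₂_update_add_of_sq_eq_zero {σ R S : Type*} [DecidableEq σ] [CommRing R] [CommRing S]
    (φ : R →+* S) (v : σ → S) (i : σ) {e : S} (he : e ^ 2 = 0) (f : MvPolynomial σ R) :
    MvPolynomial.eval₂ φ (Function.update v i (v i + e)) f =
      MvPolynomial.eval₂ φ v f + MvPolynomial.eval₂ φ v (MvPolynomial.pderiv i f) * e := by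
  induction f using MvPolynomial.induction_on with
  | C a => simp
  | add f g hf hg => simp only [MvPolynomial.eval₂_add, hf, hg, map_add]; ring
  | mul_X f j hf =>
    simp only [MvPolynomial.eval₂_mul, MvPolynomial.eval₂_X, hf, Derivation.leibniz,
      MvPolynomial.pderiv_X, smul_eq_mul, MvPolynomial.eval₂_add]
    rcases eq_or_ne j i with rfl | hj
    · simp only [Function.update_self, Pi.single_eq_same, MvPolynomial.eval₂_one]
      linear_combination (MvPolynomial.eval₂ φ v (MvPolynomial.pderiv j f)) * he
    · simp only [Function.update_of_ne hj, Pi.single_eq_of_ne hj, MvPolynomial.eval₂_zero]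
      ring

variable {p : ℕ} [hp : Fact p.Prime] {f g : PlaneRing p}

variable (f g) in
/-- Restriction of functions from the plane to `D(g) ⊆ V(f)`. -/
def toOpen : PlaneRing p →+* OpenRing f g :=
  (algebraMap (CurveRing f) (OpenRing f g)).comp (Ideal.Quotient.mk _)

theorem toOpen_self : toOpen f g f = 0 := by
  rw [toOpen, RingHom.comp_apply, Ideal.Quotient.mk_singleton_self, map_zero]

theorem isUnit_toOpen : IsUnit (toOpen f g g) :=
  IsLocalization.Away.algebraMap_isUnit (S := OpenRing f g) (Ideal.Quotient.mk (Ideal.span {f}) g)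

theorem openRing_hom_ext {E : Type*} [CommRing E] {w w' : OpenRing f g →+* E}
    (h : w.comp (toOpen f g) = w'.comp (toOpen f g)) : w = w' := by
  refine IsLocalization.ringHom_ext (Submonoid.powers (Ideal.Quotient.mk (Ideal.span {f}) g))
    (Ideal.Quotient.ringHom_ext ?_)
  exact h

theorem exists_openRing_hom {E : Type*} [CommRing E] (u : PlaneRing p →+* E) (hf : u f = 0)
    (hg : IsUnit (u g)) : ∃ w : OpenRing f g →+* E, w.comp (toOpen f g) = u := by
  let u' : CurveRing f →+* E := Ideal.Quotient.lift _ u (fun a ha => by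
    obtain ⟨c, rfl⟩ := Ideal.mem_span_singleton'.1 ha
    rw [map_mul, hf, mul_zero])
  have hu' : IsUnit (u' (Ideal.Quotient.mk _ g)) := hg
  refine ⟨IsLocalization.Away.lift _ hu', ?_⟩
  ext x <;> simp [toOpen, u']

theorem axisProj_C (i : Fin 2) (r : BaseRing p) :
    axisProj f g i (C r) = toOpen f g (MvPolynomial.C r) := by
  rw [axisProj, aeval_C]; rfl

theorem axisProj_X (i : Fin 2) : axisProj f g i X = toOpen f g (MvPolynomial.X i) := aeval_X _

/-- A lift along a square-zero ideal is a zero of `f` with prescribed `j`-th coordinate and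
prescribed reduction. First-order Taylor expansion is exact there, so the `i`-th coordinate solves a
linear equation with unit coefficient `∂f/∂x_i`. -/
theorem axisProj_formallyEtale {i j : Fin 2} (hij : i ≠ j) (h : MvPolynomial.pderiv i f ∣ g) :
    (axisProj f g j).toRingHom.FormallyEtale := by
  refine formallyEtale_of_existsUnique_lift fun {E} _ I hI u v huv => ?_
  have hsq : ∀ e ∈ I, e ^ 2 = 0 := fun e he => by
    have := Ideal.pow_mem_pow he 2
    rwa [hI] at this
  have hunit : ∀ x : E, IsUnit (Ideal.Quotient.mk I x) → IsUnit x := fun x hx =>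
    (IsNilpotent.isUnit_quotient_mk_iff ⟨2, hI⟩).1 hx
  let φ : BaseRing p →+* E := u.comp C
  have hfin : ∀ k : Fin 2, k = i ∨ k = j := fun k => by omega
  have hvC : ∀ r, v (toOpen f g (MvPolynomial.C r)) = Ideal.Quotient.mk I (φ r) := fun r => by
    rw [← axisProj_C j r]; exact (RingHom.congr_fun huv (C r)).symm
  have hvj : v (toOpen f g (MvPolynomial.X j)) = Ideal.Quotient.mk I (u X) := by
    rw [← axisProj_X]; exact (RingHom.congr_fun huv X).symm
  have hcrit : ∀ w : OpenRing f g →+* E, w.comp (axisProj f g j).toRingHom = u ↔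
      (∀ r, w (toOpen f g (MvPolynomial.C r)) = φ r) ∧
        w (toOpen f g (MvPolynomial.X j)) = u X := fun w => by
    refine ⟨fun hw => ⟨fun r => ?_, ?_⟩, fun hw => Polynomial.ringHom_ext (fun r => ?_) ?_⟩
    · rw [← axisProj_C j r]; exact RingHom.congr_fun hw (C r)
    · rw [← axisProj_X]; exact RingHom.congr_fun hw X
    · rw [← RingHom.comp_apply u, ← show φ r = _ from rfl, ← hw.1, ← axisProj_C j r]; rfl
    · rw [← hw.2, ← axisProj_X]; rfl
  have heval : ∀ (c : Fin 2 → E), (∀ k, Ideal.Quotient.mk I (c k) =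
      v (toOpen f g (MvPolynomial.X k))) → ∀ q, Ideal.Quotient.mk I (MvPolynomial.eval₂ φ c q) =
        v (toOpen f g q) := fun c hc q => by
    have h' : (Ideal.Quotient.mk I).comp (MvPolynomial.eval₂Hom φ c) = v.comp (toOpen f g) :=
      MvPolynomial.ringHom_ext (fun r => by simp [hvC]) fun k => by simp [hc]
    exact RingHom.congr_fun h' q
  have hderiv : IsUnit (v (toOpen f g (MvPolynomial.pderiv i f))) :=
    (isUnit_of_dvd_unit (map_dvd _ h) isUnit_toOpen).map v
  have huniq : ∀ w w' : OpenRing f g →+* E,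
      ((Ideal.Quotient.mk I).comp w = v ∧ w.comp (axisProj f g j).toRingHom = u) →
      ((Ideal.Quotient.mk I).comp w' = v ∧ w'.comp (axisProj f g j).toRingHom = u) → w' = w := by
    rintro w w' ⟨hw₁, hw₂⟩ ⟨hw₁', hw₂'⟩
    rw [hcrit] at hw₂ hw₂'
    let c : Fin 2 → E := fun k => w (toOpen f g (MvPolynomial.X k))
    let e : E := w' (toOpen f g (MvPolynomial.X i)) - c i
    have he : e ∈ I := by
      rw [← Ideal.Quotient.eq_zero_iff_mem, map_sub, sub_eq_zero]
      exact (RingHom.congr_fun hw₁' _).trans (RingHom.congr_fun hw₁ _).symm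
    have hwc : w.comp (toOpen f g) = MvPolynomial.eval₂Hom φ c :=
      MvPolynomial.ringHom_ext (fun r => by simp [hw₂.1]) fun k => by simp [c]
    have hwc' : w'.comp (toOpen f g) = MvPolynomial.eval₂Hom φ (Function.update c i (c i + e)) := by
      refine MvPolynomial.ringHom_ext (fun r => by simp [hw₂'.1]) fun k => ?_
      rcases hfin k with rfl | rfl
      · simp [e]
      · simp [Function.update_of_ne hij.symm, c, hw₂.2, hw₂'.2]
    have ht := eval₂_update_add_of_sq_eq_zero φ c i (hsq e he) f
    have h₁ : MvPolynomial.eval₂ φ c f = 0 := by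
      rw [← MvPolynomial.coe_eval₂Hom, ← hwc, RingHom.comp_apply, toOpen_self, map_zero]
    have h₂ : MvPolynomial.eval₂ φ (Function.update c i (c i + e)) f = 0 := by
      rw [← MvPolynomial.coe_eval₂Hom, ← hwc', RingHom.comp_apply, toOpen_self, map_zero]
    have h₃ : IsUnit (MvPolynomial.eval₂ φ c (MvPolynomial.pderiv i f)) := by
      apply hunit
      rwa [heval c fun k => RingHom.congr_fun hw₁ _]
    -- Both points are zeros of `f`, so the Taylor formula leaves a unit times `e` equal to zero.
    rw [h₁, h₂, zero_add, eq_comm, h₃.mul_right_eq_zero] at ht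
    apply openRing_hom_ext
    rw [hwc, hwc', ht, add_zero, Function.update_eq_self]
  obtain ⟨x, hx⟩ := Ideal.Quotient.mk_surjective (v (toOpen f g (MvPolynomial.X i)))
  -- The `j`-th coordinate is forced by `u`; the `i`-th is an arbitrary lift, still to be corrected.
  let c : Fin 2 → E := Function.update (fun _ => u X) i x
  have hc : ∀ k, Ideal.Quotient.mk I (c k) = v (toOpen f g (MvPolynomial.X k)) := fun k => by
    rcases hfin k with rfl | rfl
    · simp [c, hx]
    · simp [c, Function.update_of_ne hij.symm, hvj]
  have h₃ : IsUnit (MvPolynomial.eval₂ φ c (MvPolynomial.pderiv i f)) := by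
    apply hunit
    rwa [heval c hc]
  obtain ⟨y, hy⟩ := h₃.exists_right_inv
  -- Newton's correction, minus `f(c)` divided by the partial derivative; it lies in `I` because
  -- `f(c)` does.
  let e : E := -(MvPolynomial.eval₂ φ c f * y)
  have he : e ∈ I := by
    refine I.neg_mem (I.mul_mem_right _ ?_)
    rw [← Ideal.Quotient.eq_zero_iff_mem, heval c hc, toOpen_self, map_zero]
  let c' : Fin 2 → E := Function.update c i (c i + e)
  have hc' : ∀ k, Ideal.Quotient.mk I (c' k) = v (toOpen f g (MvPolynomial.X k)) := fun k => by
    rcases hfin k with rfl | rfl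
    · simp only [c', Function.update_self, map_add, Ideal.Quotient.eq_zero_iff_mem.2 he, add_zero,
        hc]
    · simp only [c', Function.update_of_ne hij.symm, hc]
  have hf : MvPolynomial.eval₂ φ c' f = 0 := by
    rw [eval₂_update_add_of_sq_eq_zero φ c i (hsq e he) f]
    linear_combination (-MvPolynomial.eval₂ φ c f) * hy
  have hg : IsUnit (MvPolynomial.eval₂ φ c' g) := by
    apply hunit
    rw [heval c' hc']
    exact isUnit_toOpen.map v
  obtain ⟨w, hw⟩ := exists_openRing_hom (MvPolynomial.eval₂Hom φ c') hf hg
  have hw' : ∀ q, w (toOpen f g q) = MvPolynomial.eval₂ φ c' q := fun q => RingHom.congr_fun hw q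
  have hmain : (Ideal.Quotient.mk I).comp w = v ∧ w.comp (axisProj f g j).toRingHom = u := by
    refine ⟨openRing_hom_ext (RingHom.ext fun q => ?_), (hcrit w).2 ⟨fun r => ?_, ?_⟩⟩
    · simp only [RingHom.comp_apply, hw']
      exact heval c' hc' q
    · rw [hw', MvPolynomial.eval₂_C]
    · rw [hw', MvPolynomial.eval₂_X]
      simp only [c', c, Function.update_of_ne hij.symm]
  exact ⟨w, hmain, fun w' hw₁ => huniq w w' hmain hw₁⟩

theorem axisProj_finitePresentation (j : Fin 2) : (axisProj f g j).toRingHom.FinitePresentation := by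
  have h₁ : Algebra.FinitePresentation (BaseRing p) (CurveRing f) :=
    .quotient ⟨{f}, by simp⟩
  have h₂ : Algebra.FinitePresentation (CurveRing f) (OpenRing f g) :=
    IsLocalization.Away.finitePresentation (Ideal.Quotient.mk (Ideal.span {f}) g)
  have h₃ : Algebra.FinitePresentation (BaseRing p) (OpenRing f g) :=
    .trans (BaseRing p) (CurveRing f) (OpenRing f g)
  algebraize [(axisProj f g j).toRingHom]
  have : IsScalarTower (BaseRing p) (BaseRing p)[X] (OpenRing f g) :=
    .of_algebraMap_eq fun r => ((axisProj f g j).commutes r).symm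
  exact Algebra.FinitePresentation.of_restrict_scalars_finitePresentation (BaseRing p) _ _

theorem axisProj_etale {i j : Fin 2} (hij : i ≠ j) (h : MvPolynomial.pderiv i f ∣ g) :
    (axisProj f g j).toRingHom.Etale := by
  have h₁ := axisProj_formallyEtale hij h
  have h₂ := axisProj_finitePresentation (f := f) (g := g) j
  algebraize [(axisProj f g j).toRingHom]
  exact { formallyEtale := h₁, finitePresentation := h₂ }

/-! ### Small degree -/

theorem reduce_eq_zero_iff : reduce f = 0 ↔ ∀ m, (p : BaseRing p) ∣ f.coeff m := by
  rw [reduce, MvPolynomial.ext_iff]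
  simp [MvPolynomial.coeff_map, Ideal.Quotient.eq_zero_iff_mem, Ideal.mem_span_singleton]

/-- If both partials vanished modulo `p`, then `p` would divide `m i * f.coeff m` for every exponent
`m` and index `i`. On the support `m i < p`, so any nonzero `m i` is prime to `p` and can be
cancelled, leaving only the constant term modulo `p`. -/
theorem exists_reduce_pderiv_ne_zero (hf : IsPlaneCurve f) (hdeg : f.totalDegree < p) :
    ∃ i, reduce (MvPolynomial.pderiv i f) ≠ 0 := by
  by_contra! h
  refine hf (Ideal.Quotient.mk _ (f.coeff 0)) (MvPolynomial.ext _ _ fun m => ?_)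
  rw [reduce, MvPolynomial.coeff_map, MvPolynomial.coeff_C]
  split_ifs with hm
  · rw [hm]
  · rw [Ideal.Quotient.eq_zero_iff_mem, Ideal.mem_span_singleton]
    by_cases hfm : f.coeff m = 0
    · rw [hfm]; exact dvd_zero _
    obtain ⟨i, hi⟩ : ∃ i, m i ≠ 0 := by
      by_contra! h'
      exact hm (Finsupp.ext fun i => (h' i).symm)
    have hmi : m i < p := ((m.le_degree i).trans
      (MvPolynomial.le_totalDegree (MvPolynomial.mem_support_iff.2 hfm))).trans_lt hdeg
    -- The coefficient of the partial derivative at this shifted exponent is the one at `m` times `m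
    -- i`; the subtraction is not truncated since `m i ≠ 0`.
    have hd := reduce_eq_zero_iff.1 (h i) (m - Finsupp.single i 1)
    have hmm : m - Finsupp.single i 1 + Finsupp.single i 1 = m :=
      tsub_add_cancel_of_le (by simpa using Nat.one_le_iff_ne_zero.2 hi)
    rw [MvPolynomial.coeff_pderiv, hmm] at hd
    have hcast : (((m - Finsupp.single i 1 : Fin 2 →₀ ℕ) i : ℕ) : BaseRing p) + 1 = (m i : ℕ) := by
      rw [← Nat.cast_succ]
      congr 1
      simp
      omega
    rw [hcast] at hd
    have hcop : IsCoprime (p : BaseRing p) ((m i : ℕ) : BaseRing p) :=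
      ((Nat.Prime.coprime_iff_not_dvd hp.out).2
        (Nat.not_dvd_of_pos_of_lt (Nat.pos_of_ne_zero hi) hmi)).cast
    exact hcop.dvd_of_dvd_mul_right hd

end

end PJet

end

theorem mainTheorem5 (p : ℕ) [Fact p.Prime] (f : PJet.PlaneRing p) (hf : PJet.IsPlaneCurve f) :
    -- the projections of `U = D(f_x)` to the `y`-axis and of `V = D(f_y)` to the `x`-axis are étale
    (PJet.axisProj f (PJet.dX f) 1).toRingHom.Etale ∧
    (PJet.axisProj f (PJet.dY f) 0).toRingHom.Etale ∧
    -- they induce trivializations of the first `p`-jet spaces of `U` and `V` modulo every `p^n`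
    (∀ n : ℕ, Function.Bijective (PJet.jetChart p n (PJet.coord f (PJet.dX f) 1)) ∧
      Function.Bijective (PJet.jetChart p n (PJet.coord f (PJet.dY f) 0))) ∧
    -- over `U ∩ V = D(f_x f_y)` both transition maps modulo `p^n` lie in `A_n`
    ((PJet.reduce (PJet.dX f) ≠ 0 ∨ PJet.reduce (PJet.dY f) ≠ 0) →
      ∀ n : ℕ, 2 ≤ n →
        ∃ (hU : Function.Bijective
              (PJet.jetChart p n (PJet.coord f (PJet.dX f * PJet.dY f) 1)))
          (hV : Function.Bijective
              (PJet.jetChart p n (PJet.coord f (PJet.dX f * PJet.dY f) 0))),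
          PJet.jetTransition p n hU hV ∈ PJet.boundedAut p n _ ∧
          PJet.jetTransition p n hV hU ∈ PJet.boundedAut p n _) ∧
    -- small degree
    (f.totalDegree < p → PJet.reduce (PJet.dX f) ≠ 0 ∨ PJet.reduce (PJet.dY f) ≠ 0) := by
  have h01 : (0 : Fin 2) ≠ 1 := by decide
  have hU : ∀ g, PJet.dX f ∣ g → (PJet.axisProj f g 1).toRingHom.FormallyEtale :=
    fun g hg => PJet.axisProj_formallyEtale h01 hg
  have hV : ∀ g, PJet.dY f ∣ g → (PJet.axisProj f g 0).toRingHom.FormallyEtale :=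
    fun g hg => PJet.axisProj_formallyEtale h01.symm hg
  have hU' := hU _ (dvd_mul_right (PJet.dX f) (PJet.dY f))
  have hV' := hV _ (dvd_mul_left (PJet.dY f) (PJet.dX f))
  refine ⟨PJet.axisProj_etale h01 dvd_rfl, PJet.axisProj_etale h01.symm dvd_rfl,
    fun n => ⟨PJet.jetChart_bijective (hU _ dvd_rfl) n, PJet.jetChart_bijective (hV _ dvd_rfl) n⟩,
    fun _ n _ => ⟨PJet.jetChart_bijective hU' n, PJet.jetChart_bijective hV' n,
      PJet.jetTransition_mem_boundedAut hU' _ _, PJet.jetTransition_mem_boundedAut hV' _ _⟩,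
    fun hdeg => ?_⟩
  obtain ⟨i, hi⟩ := PJet.exists_reduce_pderiv_ne_zero hf hdeg
  fin_cases i
  · exact Or.inl hi
  · exact Or.inr hi
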